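/- Let $N\ge 3$ be an integer, let $\sigma,s\in[0,2)$, and write $2^*(s):=\frac{2(N-s)}{N-2}$. Let $D_0^{1,2}(\mathbb R^N)$ be the completion of $C_c^\infty(\mathbb R^N)$ for the norm $\|\nabla\varphi\|_{L^2}$, regarded as a space of real functions in $L^{2^*(0)}(\mathbb R^N)$, and let $$E:=D_0^{1,2}(\mathbb R^N)\cap L^2\Big(\mathbb R^N,\frac{dx}{|x|^\sigma}\Big),\qquad \|u\|_E:=\Big(\int_{\mathbb R^N}\Big(|\nabla u|^2+\frac{|u|^2}{|x|^\sigma}\Big)dx\Big)^{1/2}.$$ Suppose that $p\in\mathbb R$ satisfies either (i) $\sigma\le s$ and $2<p<2^*(s)$, or (ii) $\sigma>s$ and $2+\frac4\sigma\,\frac{\sigma-s}{N-2}\le p<2^*(s)$. Then $E\subset L^p\big(\mathbb R^N,\frac{dx}{|x|^s}\big)$, and the inclusion $(E,\|\cdot\|_E)\hookrightarrow L^p\big(\mathbb R^N,\frac{dx}{|x|^s}\big)$ is continuous. Moreover, this embedding is compact if $\sigma<s$ (and $2<p<2^*(s)$), or if $0<s\le\sigma$ and $2+\frac4\sigma\,\frac{\sigma-s}{N-2}<p<2^*(s)$.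 -/

import Mathlib

open MeasureTheory Filter Topology
open scoped ENNReal ContDiff Gradient

/-- The critical Hardy-Sobolev exponent `2^*(s) = 2 (N - s) / (N - 2)`. -/
noncomputable def hardySobolevExponent (N : ℕ) (s : ℝ) : ℝ :=
  2 * ((N : ℝ) - s) / ((N : ℝ) - 2)

/-- The measure `dx / |x|^s` on `ℝ^N`. -/
noncomputable def weightedVolume (N : ℕ) (s : ℝ) : Measure (EuclideanSpace ℝ (Fin N)) :=
  volume.withDensity fun x => ENNReal.ofReal (1 / ‖x‖ ^ s)

/-- `u ∈ D_0^{1,2}(ℝ^N)` with gradient `G`.  The space `D_0^{1,2}(ℝ^N)` is the completion of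
`C_c^∞(ℝ^N)` for the norm `‖∇ φ‖_{L²}`, realised (`N ≥ 3`) as a space of functions in `L^{2^*}`:
there are test functions `φ_n` with `φ_n → u` in `L^{2^*}` and `∇ φ_n → G` in `L²`. -/
structure HasDGradient {N : ℕ} (u : EuclideanSpace ℝ (Fin N) → ℝ)
    (G : EuclideanSpace ℝ (Fin N) → EuclideanSpace ℝ (Fin N)) : Prop where
  memLp : MemLp u (ENNReal.ofReal (hardySobolevExponent N 0)) volume
  memLp_grad : MemLp G 2 volume
  exists_approx : ∃ φ : ℕ → EuclideanSpace ℝ (Fin N) → ℝ,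
    (∀ n, ContDiff ℝ ∞ (φ n) ∧ HasCompactSupport (φ n)) ∧
    Tendsto (fun n => eLpNorm (φ n - u) (ENNReal.ofReal (hardySobolevExponent N 0)) volume)
      atTop (𝓝 0) ∧
    Tendsto (fun n => eLpNorm (∇ (φ n) - G) 2 volume) atTop (𝓝 0)

section Helpers

variable {N : ℕ}

theorem one_le_hardySobolevExponent_zero [hN : Fact (3 ≤ N)] :
    1 ≤ ENNReal.ofReal (hardySobolevExponent N 0) := by
  have h : (3 : ℝ) ≤ N := by exact_mod_cast hN.out
  rw [ENNReal.one_le_ofReal, hardySobolevExponent, le_div_iff₀ (by linarith)]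
  linarith

theorem continuous_gradient_of_contDiff {φ : EuclideanSpace ℝ (Fin N) → ℝ}
    (h : ContDiff ℝ ∞ φ) : Continuous (∇ φ) :=
  (InnerProductSpace.toDual ℝ (EuclideanSpace ℝ (Fin N))).symm.continuous.comp
    (h.continuous_fderiv (by simp))

theorem gradient_add_of_contDiff {φ ψ : EuclideanSpace ℝ (Fin N) → ℝ}
    (h : ContDiff ℝ ∞ φ) (h' : ContDiff ℝ ∞ ψ) : ∇ (φ + ψ) = ∇ φ + ∇ ψ := by
  ext1 x
  have h1 : DifferentiableAt ℝ φ x := h.differentiable (by simp) x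
  have h2 : DifferentiableAt ℝ ψ x := h'.differentiable (by simp) x
  simp [gradient, fderiv_add h1 h2]

theorem gradient_const_smul_of_contDiff {φ : EuclideanSpace ℝ (Fin N) → ℝ} (c : ℝ)
    (h : ContDiff ℝ ∞ φ) : ∇ (c • φ) = c • ∇ φ := by
  ext1 x
  have h1 : DifferentiableAt ℝ φ x := h.differentiable (by simp) x
  simp [gradient, fderiv_const_smul h1 c]

namespace HasDGradient

variable {u v : EuclideanSpace ℝ (Fin N) → ℝ}
  {G H : EuclideanSpace ℝ (Fin N) → EuclideanSpace ℝ (Fin N)}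

theorem congr {u' : EuclideanSpace ℝ (Fin N) → ℝ}
    {G' : EuclideanSpace ℝ (Fin N) → EuclideanSpace ℝ (Fin N)}
    (h : HasDGradient u G) (hu : u =ᵐ[volume] u') (hG : G =ᵐ[volume] G') :
    HasDGradient u' G' := by
  obtain ⟨φ, h1, h2, h3⟩ := h.exists_approx
  refine ⟨(memLp_congr_ae hu).1 h.memLp, (memLp_congr_ae hG).1 h.memLp_grad, φ, h1, ?_, ?_⟩
  · refine h2.congr fun n => eLpNorm_congr_ae ?_
    filter_upwards [hu] with x hx
    simp [hx]
  · refine h3.congr fun n => eLpNorm_congr_ae ?_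
    filter_upwards [hG] with x hx
    simp [hx]

theorem zero : HasDGradient (0 : EuclideanSpace ℝ (Fin N) → ℝ) 0 := by
  refine ⟨MemLp.zero, MemLp.zero, fun _ => 0, fun _ => ⟨contDiff_const, HasCompactSupport.zero⟩,
    by simp, ?_⟩
  have : ∇ (0 : EuclideanSpace ℝ (Fin N) → ℝ) = 0 := by
    ext1 x; simp [gradient]
  simp [this]

theorem const_smul (c : ℝ) (h : HasDGradient u G) : HasDGradient (c • u) (c • G) := by
  obtain ⟨φ, h1, h2, h3⟩ := h.exists_approx
  refine ⟨h.memLp.const_smul c, h.memLp_grad.const_smul c, fun n => c • φ n,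
    fun n => ⟨contDiff_const.smul (h1 n).1, (h1 n).2.smul_left⟩, ?_, ?_⟩
  · have : Tendsto (fun n => ‖c‖ₑ *
        eLpNorm (φ n - u) (ENNReal.ofReal (hardySobolevExponent N 0)) volume) atTop (𝓝 0) := by
      simpa using ENNReal.Tendsto.const_mul h2 (Or.inr enorm_ne_top)
    refine this.congr fun n => ?_
    rw [← smul_sub, eLpNorm_const_smul]
  · have : Tendsto (fun n => ‖c‖ₑ * eLpNorm (∇ (φ n) - G) 2 volume) atTop (𝓝 0) := by
      simpa using ENNReal.Tendsto.const_mul h3 (Or.inr enorm_ne_top)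
    refine this.congr fun n => ?_
    rw [gradient_const_smul_of_contDiff c (h1 n).1, ← smul_sub, eLpNorm_const_smul]

theorem add [Fact (3 ≤ N)] (h : HasDGradient u G) (h' : HasDGradient v H) :
    HasDGradient (u + v) (G + H) := by
  obtain ⟨φ, h1, h2, h3⟩ := h.exists_approx
  obtain ⟨ψ, k1, k2, k3⟩ := h'.exists_approx
  refine ⟨h.memLp.add h'.memLp, h.memLp_grad.add h'.memLp_grad, fun n => φ n + ψ n,
    fun n => ⟨(h1 n).1.add (k1 n).1, (h1 n).2.add (k1 n).2⟩, ?_, ?_⟩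
  · refine tendsto_of_tendsto_of_tendsto_of_le_of_le tendsto_const_nhds
      (by simpa using h2.add k2) (fun _ => zero_le) fun n => ?_
    have e : φ n + ψ n - (u + v) = (φ n - u) + (ψ n - v) := by abel
    simp only [e]
    exact eLpNorm_add_le ((h1 n).1.continuous.aestronglyMeasurable.sub h.memLp.1)
      ((k1 n).1.continuous.aestronglyMeasurable.sub h'.memLp.1)
      one_le_hardySobolevExponent_zero
  · refine tendsto_of_tendsto_of_tendsto_of_le_of_le tendsto_const_nhds
      (by simpa using h3.add k3) (fun _ => zero_le) fun n => ?_
    have e : ∇ (φ n + ψ n) - (G + H) = (∇ (φ n) - G) + (∇ (ψ n) - H) := by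
      rw [gradient_add_of_contDiff (h1 n).1 (k1 n).1]; abel
    simp only [e]
    exact eLpNorm_add_le
      ((continuous_gradient_of_contDiff (h1 n).1).aestronglyMeasurable.sub h.memLp_grad.1)
      ((continuous_gradient_of_contDiff (k1 n).1).aestronglyMeasurable.sub h'.memLp_grad.1)
      (by norm_num)

end HasDGradient

theorem tendsto_integral_smul_of_tendsto_eLpNorm {F : Type*} [NormedAddCommGroup F]
    [NormedSpace ℝ F] {p : ℝ≥0∞} (hp : 1 ≤ p)
    {g : EuclideanSpace ℝ (Fin N) → ℝ} (hg : Continuous g) (hgc : HasCompactSupport g)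
    {f : ℕ → EuclideanSpace ℝ (Fin N) → F} {f₀ : EuclideanSpace ℝ (Fin N) → F}
    (hfm : ∀ n, MemLp (f n) p volume) (hf₀ : MemLp f₀ p volume)
    (hf : Tendsto (fun n => eLpNorm (f n - f₀) p volume) atTop (𝓝 0)) :
    Tendsto (fun n => ∫ x, g x • f n x) atTop (𝓝 (∫ x, g x • f₀ x)) := by
  have : Fact (1 ≤ p) := ⟨hp⟩
  let q := ENNReal.conjExponent p
  have hq : ENNReal.HolderConjugate q p :=
    (ENNReal.HolderConjugate.conjExponent hp).symm
  have hgq : MemLp g q volume := hg.memLp_of_hasCompactSupport hgc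
  have hint : ∀ {w : EuclideanSpace ℝ (Fin N) → F}, MemLp w p volume →
      Integrable (fun x => g x • w x) volume := fun hw =>
    memLp_one_iff_integrable.1 (hw.smul hgq)
  refine tendsto_integral_of_L1' _ (hint hf₀).1 (Eventually.of_forall fun n => hint (hfm n)) ?_
  refine tendsto_of_tendsto_of_tendsto_of_le_of_le tendsto_const_nhds
    (h := fun n => eLpNorm g q volume * eLpNorm (f n - f₀) p volume)
    (by simpa using ENNReal.Tendsto.const_mul hf (Or.inr hgq.2.ne)) (fun _ => zero_le)
    fun n => ?_
  have e : (fun x => g x • f n x) - (fun x => g x • f₀ x) = g • (f n - f₀) := by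
    ext x; simp [smul_sub]
  simp only [e]
  exact eLpNorm_smul_le_mul_eLpNorm ((hfm n).1.sub hf₀.1) hgq.1

/-- The limit gradient is the weak gradient. -/
theorem HasDGradient.integral_smul_inner [Fact (3 ≤ N)] {u : EuclideanSpace ℝ (Fin N) → ℝ}
    {G : EuclideanSpace ℝ (Fin N) → EuclideanSpace ℝ (Fin N)} (h : HasDGradient u G)
    (e : EuclideanSpace ℝ (Fin N)) {g : EuclideanSpace ℝ (Fin N) → ℝ} (hg : ContDiff ℝ ∞ g)
    (hgc : HasCompactSupport g) :
    ∫ x, g x • inner ℝ e (G x) = - ∫ x, fderiv ℝ g x e • u x := by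
  obtain ⟨φ, h1, h2, h3⟩ := h.exists_approx
  have hdg : Continuous fun x => fderiv ℝ g x e :=
    (hg.continuous_fderiv (by simp)).clm_apply continuous_const
  have hdφ : ∀ n, Continuous fun x => fderiv ℝ (φ n) x e := fun n =>
    ((h1 n).1.continuous_fderiv (by simp)).clm_apply continuous_const
  have hin : ∀ n x, inner ℝ e (∇ (φ n) x) = fderiv ℝ (φ n) x e := fun n x => by
    rw [real_inner_comm, gradient, InnerProductSpace.toDual_symm_apply]
  have hgradc : ∀ n, HasCompactSupport (∇ (φ n)) := fun n =>
    ((h1 n).2.fderiv (𝕜 := ℝ)).comp_left (map_zero _)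
  have A : Tendsto (fun n => ∫ x, g x • inner ℝ e (∇ (φ n) x)) atTop
      (𝓝 (∫ x, g x • inner ℝ e (G x))) := by
    refine tendsto_integral_smul_of_tendsto_eLpNorm (p := 2) (by norm_num) hg.continuous hgc
      (fun n => ((continuous_gradient_of_contDiff (h1 n).1).memLp_of_hasCompactSupport
        (hgradc n)).const_inner e)
      (h.memLp_grad.const_inner e) ?_
    refine tendsto_of_tendsto_of_tendsto_of_le_of_le tendsto_const_nhds
      (h := fun n => ‖e‖ₑ * eLpNorm (∇ (φ n) - G) 2 volume)
      (by simpa using ENNReal.Tendsto.const_mul h3 (Or.inr (enorm_ne_top (x := e))))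
      (fun _ => zero_le) fun n => ?_
    rw [← ofReal_norm e]
    refine eLpNorm_le_mul_eLpNorm_of_ae_le_mul (Eventually.of_forall fun x => ?_) 2
    simp only [Pi.sub_apply, ← inner_sub_right]
    exact norm_inner_le_norm _ _
  have B : Tendsto (fun n => ∫ x, fderiv ℝ g x e • φ n x) atTop
      (𝓝 (∫ x, fderiv ℝ g x e • u x)) :=
    tendsto_integral_smul_of_tendsto_eLpNorm one_le_hardySobolevExponent_zero hdg
      (hgc.fderiv_apply ℝ e)
      (fun n => (h1 n).1.continuous.memLp_of_hasCompactSupport (h1 n).2) h.memLp h2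
  refine tendsto_nhds_unique A (B.neg.congr fun n => ?_)
  simp only [hin, smul_eq_mul]
  symm
  refine integral_mul_fderiv_eq_neg_fderiv_mul_of_integrable ?_ ?_ ?_
    (fun x _ => hg.differentiable (by simp) x) (fun x _ => (h1 n).1.differentiable (by simp) x)
  · exact (hdg.mul (h1 n).1.continuous).integrable_of_hasCompactSupport
      ((hgc.fderiv_apply ℝ e).mul_right)
  · exact (hg.continuous.mul (hdφ n)).integrable_of_hasCompactSupport hgc.mul_right
  · exact (hg.continuous.mul (h1 n).1.continuous).integrable_of_hasCompactSupport hgc.mul_right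

theorem HasDGradient.unique [Fact (3 ≤ N)] {u : EuclideanSpace ℝ (Fin N) → ℝ}
    {G H : EuclideanSpace ℝ (Fin N) → EuclideanSpace ℝ (Fin N)} (h : HasDGradient u G)
    (h' : HasDGradient u H) : G =ᵐ[volume] H := by
  have hK : ∀ e : EuclideanSpace ℝ (Fin N),
      (fun x => inner ℝ e (G x) - inner ℝ e (H x)) =ᵐ[volume] fun _ => (0 : ℝ) := by
    intro e
    have hGe : MemLp (fun x => inner ℝ e (G x)) 2 volume := h.memLp_grad.const_inner e
    have hHe : MemLp (fun x => inner ℝ e (H x)) 2 volume := h'.memLp_grad.const_inner e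
    refine ae_eq_zero_of_integral_contDiff_smul_eq_zero
      ((hGe.locallyIntegrable (by norm_num)).sub (hHe.locallyIntegrable (by norm_num))) ?_
    intro g hg hgc
    have hgq : MemLp g 2 volume := hg.continuous.memLp_of_hasCompactSupport hgc
    have i1 : Integrable (fun x => g x • inner ℝ e (G x)) volume :=
      memLp_one_iff_integrable.1 (hGe.smul hgq)
    have i2 : Integrable (fun x => g x • inner ℝ e (H x)) volume :=
      memLp_one_iff_integrable.1 (hHe.smul hgq)
    simp only [smul_sub]
    rw [integral_sub i1 i2, h.integral_smul_inner e hg hgc, h'.integral_smul_inner e hg hgc,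
      sub_self]
  have : ∀ᵐ x ∂(volume : Measure (EuclideanSpace ℝ (Fin N))), ∀ i : Fin N, G x i = H x i := by
    rw [ae_all_iff]
    intro i
    filter_upwards [hK (EuclideanSpace.single i 1)] with x hx
    simpa [sub_eq_zero, EuclideanSpace.inner_single_left] using hx
  filter_upwards [this] with x hx
  ext i
  exact hx i

theorem measurable_weight (s : ℝ) :
    Measurable fun x : EuclideanSpace ℝ (Fin N) => ENNReal.ofReal (1 / ‖x‖ ^ s) := by
  fun_prop

theorem weightedVolume_absolutelyContinuous (s : ℝ) :
    weightedVolume N s ≪ volume :=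
  withDensity_absolutelyContinuous _ _

theorem absolutelyContinuous_weightedVolume [hN : Fact (3 ≤ N)] (s : ℝ) :
    (volume : Measure (EuclideanSpace ℝ (Fin N))) ≪ weightedVolume N s := by
  have : Nonempty (Fin N) := ⟨⟨0, by have := hN.out; omega⟩⟩
  refine withDensity_absolutelyContinuous' (measurable_weight s).aemeasurable ?_
  filter_upwards [Measure.ae_ne volume (0 : EuclideanSpace ℝ (Fin N))] with x hx
  have : 0 < 1 / ‖x‖ ^ s := by positivity
  simpa using this

theorem integral_weightedVolume (s : ℝ) (f : EuclideanSpace ℝ (Fin N) → ℝ) :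
    ∫ x, f x ∂(weightedVolume N s) = ∫ x, f x / ‖x‖ ^ s := by
  rw [weightedVolume, integral_withDensity_eq_integral_toReal_smul (measurable_weight s)
    (Eventually.of_forall fun x => ENNReal.ofReal_lt_top)]
  refine integral_congr_ae (Eventually.of_forall fun x => ?_)
  have : 0 ≤ 1 / ‖x‖ ^ s := by positivity
  simp only [ENNReal.toReal_ofReal this, smul_eq_mul]
  ring

theorem integrable_weightedVolume {s : ℝ} {f : EuclideanSpace ℝ (Fin N) → ℝ}
    (hf : Integrable f (weightedVolume N s)) : Integrable (fun x => f x / ‖x‖ ^ s) volume := by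
  rw [weightedVolume, integrable_withDensity_iff_integrable_smul' (measurable_weight s)
    (Eventually.of_forall fun x => ENNReal.ofReal_lt_top)] at hf
  refine hf.congr (Eventually.of_forall fun x => ?_)
  have : 0 ≤ 1 / ‖x‖ ^ s := by positivity
  simp only [ENNReal.toReal_ofReal this, smul_eq_mul]
  ring

theorem norm_sq_toLp_eq_integral {F : Type*} [NormedAddCommGroup F] [InnerProductSpace ℝ F]
    {μ : Measure (EuclideanSpace ℝ (Fin N))} {f : EuclideanSpace ℝ (Fin N) → F}
    (hf : MemLp f 2 μ) : ‖hf.toLp f‖ ^ 2 = ∫ x, ‖f x‖ ^ 2 ∂μ := by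
  rw [← real_inner_self_eq_norm_sq, L2.inner_def]
  refine integral_congr_ae ?_
  filter_upwards [hf.coeFn_toLp] with x hx
  rw [hx, real_inner_self_eq_norm_sq]

end Helpers

/-- `D_0^{1,2}(ℝ^N)`, as a space of functions modulo equality almost everywhere. -/
def DSpace (N : ℕ) [Fact (3 ≤ N)] :
    Submodule ℝ (EuclideanSpace ℝ (Fin N) →ₘ[volume] ℝ) where
  carrier := {u | ∃ G, HasDGradient u G}
  add_mem' := by
    rintro u v ⟨G, hG⟩ ⟨H, hH⟩
    exact ⟨G + H, (hG.add hH).congr (AEEqFun.coeFn_add u v).symm (ae_eq_refl _)⟩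
  zero_mem' := ⟨0, HasDGradient.zero.congr AEEqFun.coeFn_zero.symm (ae_eq_refl _)⟩
  smul_mem' := by
    rintro c u ⟨G, hG⟩
    exact ⟨c • G, (hG.const_smul c).congr (AEEqFun.coeFn_smul c u).symm (ae_eq_refl _)⟩

/-- The functions (modulo equality a.e.) that belong to `L²(ℝ^N, dx / |x|^σ)`. -/
def weightedL2 (N : ℕ) (σ : ℝ) :
    Submodule ℝ (EuclideanSpace ℝ (Fin N) →ₘ[volume] ℝ) where
  carrier := {u | MemLp u 2 (weightedVolume N σ)}
  add_mem' := by
    intro u v hu hv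
    exact (memLp_congr_ae ((weightedVolume_absolutelyContinuous σ).ae_eq
      (AEEqFun.coeFn_add u v))).2 (MemLp.add hu hv)
  zero_mem' := (memLp_congr_ae ((weightedVolume_absolutelyContinuous σ).ae_eq
      AEEqFun.coeFn_zero)).2 MemLp.zero
  smul_mem' := by
    intro c u hu
    exact (memLp_congr_ae ((weightedVolume_absolutelyContinuous σ).ae_eq
      (AEEqFun.coeFn_smul c u))).2 (MemLp.const_smul hu c)

/-- `E = D_0^{1,2}(ℝ^N) ∩ L²(ℝ^N, dx / |x|^σ)`. -/
def ESpace (N : ℕ) [Fact (3 ≤ N)] (σ : ℝ) : Type :=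
  ↥(DSpace N ⊓ weightedL2 N σ)

namespace ESpace

variable {N : ℕ} [Fact (3 ≤ N)] {σ : ℝ}

noncomputable instance : AddCommGroup (ESpace N σ) :=
  inferInstanceAs (AddCommGroup ↥(DSpace N ⊓ weightedL2 N σ))

noncomputable instance : Module ℝ (ESpace N σ) :=
  inferInstanceAs (Module ℝ ↥(DSpace N ⊓ weightedL2 N σ))

/-- The function underlying an element of `E`. -/
noncomputable def toFun (u : ESpace N σ) : EuclideanSpace ℝ (Fin N) → ℝ :=
  (u.1 : EuclideanSpace ℝ (Fin N) →ₘ[volume] ℝ)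

/-- The gradient of an element of `E` (unique a.e.). -/
noncomputable def grad (u : ESpace N σ) :
    EuclideanSpace ℝ (Fin N) → EuclideanSpace ℝ (Fin N) :=
  Classical.choose u.2.1

theorem hasDGradient (u : ESpace N σ) : HasDGradient u.toFun u.grad :=
  Classical.choose_spec u.2.1

theorem memLp_weighted (u : ESpace N σ) : MemLp u.toFun 2 (weightedVolume N σ) := u.2.2

theorem toFun_add (u v : ESpace N σ) : (u + v).toFun =ᵐ[volume] u.toFun + v.toFun :=
  AEEqFun.coeFn_add u.1 v.1

theorem toFun_smul (c : ℝ) (u : ESpace N σ) : (c • u).toFun =ᵐ[volume] c • u.toFun :=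
  AEEqFun.coeFn_smul c u.1

/-- The isometric linear map `u ↦ (∇ u, u)` into `L²(dx) × L²(dx / |x|^σ)`. -/
noncomputable def graphMap : ESpace N σ →ₗ[ℝ]
    WithLp 2 (Lp (EuclideanSpace ℝ (Fin N)) 2 (volume : Measure (EuclideanSpace ℝ (Fin N))) ×
      Lp ℝ 2 (weightedVolume N σ)) where
  toFun u := WithLp.toLp 2 (u.hasDGradient.memLp_grad.toLp _, u.memLp_weighted.toLp _)
  map_add' u v := by
    rw [← WithLp.toLp_add, Prod.mk_add_mk, ← MemLp.toLp_add, ← MemLp.toLp_add]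
    congr 2
    · exact MemLp.toLp_congr _ _ ((u + v).hasDGradient.unique
        ((u.hasDGradient.add v.hasDGradient).congr (toFun_add u v).symm (ae_eq_refl _)))
    · exact MemLp.toLp_congr _ _
        ((weightedVolume_absolutelyContinuous σ).ae_eq (toFun_add u v))
  map_smul' c u := by
    rw [RingHom.id_apply, ← WithLp.toLp_smul, Prod.smul_mk, ← MemLp.toLp_const_smul,
      ← MemLp.toLp_const_smul]
    congr 2
    · exact MemLp.toLp_congr _ _ ((c • u).hasDGradient.unique
        ((u.hasDGradient.const_smul c).congr (toFun_smul c u).symm (ae_eq_refl _)))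
    · exact MemLp.toLp_congr _ _
        ((weightedVolume_absolutelyContinuous σ).ae_eq (toFun_smul c u))

theorem graphMap_injective : Function.Injective (graphMap (N := N) (σ := σ)) := by
  intro u v h
  have h2 : u.memLp_weighted.toLp _ = v.memLp_weighted.toLp _ :=
    congrArg (fun z => (WithLp.ofLp z).2) h
  have h3 : u.toFun =ᵐ[volume] v.toFun :=
    (absolutelyContinuous_weightedVolume σ).ae_eq
      ((MemLp.toLp_eq_toLp_iff _ _).1 h2)
  exact Subtype.ext (AEEqFun.ext h3)

/-- `‖u‖_E = (∫ (|∇u|² + |u|² / |x|^σ) dx)^{1/2}`. -/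
noncomputable def energyNorm (u : ESpace N σ) : ℝ :=
  √(∫ x, (‖u.grad x‖ ^ 2 + |u.toFun x| ^ 2 / ‖x‖ ^ σ))

theorem energyNorm_eq (u : ESpace N σ) : u.energyNorm = ‖graphMap u‖ := by
  have e : ‖graphMap u‖ = √(‖u.hasDGradient.memLp_grad.toLp _‖ ^ 2 +
      ‖u.memLp_weighted.toLp _‖ ^ 2) := WithLp.prod_norm_eq_of_L2 _
  rw [e, norm_sq_toLp_eq_integral, norm_sq_toLp_eq_integral, integral_weightedVolume, energyNorm,
    integral_add]
  · simp only [Real.norm_eq_abs]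
  · exact u.hasDGradient.memLp_grad.integrable_norm_pow (by norm_num)
  · exact integrable_weightedVolume
      (f := fun x => |u.toFun x| ^ 2) (u.memLp_weighted.integrable_norm_pow (by norm_num))

noncomputable instance : NormedAddCommGroup (ESpace N σ) :=
  AddGroupNorm.toNormedAddCommGroup
    { toFun := energyNorm
      map_zero' := by rw [energyNorm_eq, map_zero, norm_zero]
      add_le' := fun u v => by
        simp only [energyNorm_eq, map_add]
        exact norm_add_le _ _
      neg' := fun u => by simp only [energyNorm_eq, map_neg, norm_neg]
      eq_zero_of_map_eq_zero' := fun u h => by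
        have h' : energyNorm u = 0 := h
        rw [energyNorm_eq, norm_eq_zero] at h'
        exact graphMap_injective (h'.trans (map_zero _).symm) }

noncomputable instance : NormedSpace ℝ (ESpace N σ) where
  norm_smul_le c u := by
    change energyNorm (c • u) ≤ ‖c‖ * energyNorm u
    rw [energyNorm_eq, energyNorm_eq, map_smul]
    exact norm_smul_le _ _

end ESpace

/-! Write q = 2^*(0). The hypotheses enter only through two linear conditions: `hin`, s q < N (q -
p), which is p < 2^*(s); and `hout`, σ (q - p) ≤ s (q - 2), which for σ > 0 is the lower bound on p.

Continuity. On the unit ball, Young's inequality bounds |u|^p / |x|^s by |u|^q + |x|^(-s q / (q -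
p)), and `hin` makes the last power integrable. Off the unit ball, |u|^p is interpolated between
|u|^2 / |x|^σ and |u|^q, and `hout` says that the resulting weight dominates |x|^(-s). The Sobolev
inequality bounds the integral of |u|^q. This is `exists_lintegral_rpow_div_le`.

Compactness. If `hout` is strict, both conditions are open, so the bound survives replacing s by s ±
η or p by p + η. Up to a factor L^(-η), this controls the regions |x| ≤ 1/L, |x| ≥ L and |u| ≥ L; on
the rest, the integrand is at most a constant times |u|^2 (`rpow_div_rpow_le_of_one_le`). The local
L^2 norm is a Rellich-type quantity: since translates satisfy ‖u(· + h) - u‖_2 ≤ |h| ‖∇u‖_2, it is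
small once finitely many averages over small balls are small (`exists_averages_control`). Hence on
bounded sets the norm in the target is small wherever finitely many continuous functionals are
small, and this implies compactness (`isCompactOperator_of_finite_functionals`) with no appeal to
weak convergence. -/

/-! ### Sobolev inequality and L^2 estimate for translates -/

theorem sq_lintegral_le {α : Type*} [MeasurableSpace α] {μ : Measure α} {f : α → ℝ≥0∞}
    (hf : AEMeasurable f μ) : (∫⁻ x, f x ∂μ) ^ 2 ≤ μ Set.univ * ∫⁻ x, f x ^ 2 ∂μ := by
  have h := ENNReal.lintegral_mul_le_Lp_mul_Lq μ Real.HolderConjugate.two_two hf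
    (aemeasurable_const (b := (1 : ℝ≥0∞)))
  simp only [Pi.mul_apply, mul_one, lintegral_const, one_pow, one_mul,
    ENNReal.rpow_two] at h
  calc (∫⁻ x, f x ∂μ) ^ 2
      ≤ ((∫⁻ x, f x ^ 2 ∂μ) ^ (1 / 2 : ℝ) * μ Set.univ ^ (1 / 2 : ℝ)) ^ 2 := by gcongr
    _ = μ Set.univ * ∫⁻ x, f x ^ 2 ∂μ := by
      rw [mul_pow, ← ENNReal.rpow_two, ← ENNReal.rpow_two, ← ENNReal.rpow_mul, ← ENNReal.rpow_mul]
      norm_num [mul_comm]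

theorem eLpNorm_two_sq {α F : Type*} [MeasurableSpace α] [NormedAddCommGroup F] {μ : Measure α}
    (f : α → F) : eLpNorm f 2 μ ^ 2 = ∫⁻ x, ‖f x‖ₑ ^ 2 ∂μ := by
  have := eLpNorm_nnreal_pow_eq_lintegral (f := f) (μ := μ) (p := 2) (by norm_num)
  simpa using this

section

variable {N : ℕ}

theorem enorm_gradient (φ : EuclideanSpace ℝ (Fin N) → ℝ) (x : EuclideanSpace ℝ (Fin N)) :
    ‖∇ φ x‖ₑ = ‖fderiv ℝ φ x‖ₑ := by
  simp [gradient, enorm_eq_nnnorm]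

theorem two_lt_hardySobolevExponent_zero [hN : Fact (3 ≤ N)] : 2 < hardySobolevExponent N 0 := by
  have h : (3 : ℝ) ≤ N := by exact_mod_cast hN.out
  rw [hardySobolevExponent, lt_div_iff₀ (by linarith)]
  linarith

/-- The Sobolev inequality on `D_0^{1,2}(ℝ^N)`. -/
theorem exists_eLpNorm_le_of_hasDGradient (N : ℕ) [hN : Fact (3 ≤ N)] :
    ∃ C : NNReal, ∀ (u : EuclideanSpace ℝ (Fin N) → ℝ)
      (G : EuclideanSpace ℝ (Fin N) → EuclideanSpace ℝ (Fin N)), HasDGradient u G →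
      eLpNorm u (ENNReal.ofReal (hardySobolevExponent N 0)) volume ≤ C * eLpNorm G 2 volume := by
  have h3 : (3 : ℝ) ≤ N := by exact_mod_cast hN.out
  refine ⟨SNormLESNormFDerivOfEqConst ℝ (volume : Measure (EuclideanSpace ℝ (Fin N))) (2 : NNReal),
    fun u G h => ?_⟩
  set C := SNormLESNormFDerivOfEqConst ℝ (volume : Measure (EuclideanSpace ℝ (Fin N))) (2 : NNReal)
  have hsob : ∀ φ : EuclideanSpace ℝ (Fin N) → ℝ, ContDiff ℝ ∞ φ → HasCompactSupport φ →
      eLpNorm φ (ENNReal.ofReal (hardySobolevExponent N 0)) volume ≤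
        C * eLpNorm (∇ φ) 2 volume := by
    intro φ h1 h2
    have := eLpNorm_le_eLpNorm_fderiv_of_eq (volume : Measure (EuclideanSpace ℝ (Fin N)))
      (u := φ) (h1.of_le (by simp)) h2 (p := 2) (p' := (hardySobolevExponent N 0).toNNReal)
      (by norm_num) (by have := hN.out; simp; omega) (by
        rw [Real.coe_toNNReal _ (by linarith [two_lt_hardySobolevExponent_zero (N := N)]),
          hardySobolevExponent]
        have h2 : (N : ℝ) - 2 ≠ 0 := by linarith
        simp
        field_simp)
    refine this.trans_eq ?_
    congr 1
    exact eLpNorm_congr_enorm_ae (Eventually.of_forall fun x => (enorm_gradient φ x).symm)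
  obtain ⟨φ, h1, h2, h3⟩ := h.exists_approx
  -- Passage to the limit from test functions: each term of this sequence bounds the norm of u, by
  -- the triangle inequality in L^q and in L^2.
  have hlim : Tendsto (fun n => eLpNorm (φ n - u) (ENNReal.ofReal (hardySobolevExponent N 0)) volume
      + C * (eLpNorm (∇ (φ n) - G) 2 volume + eLpNorm G 2 volume)) atTop
      (𝓝 (0 + C * (0 + eLpNorm G 2 volume))) :=
    h2.add (ENNReal.Tendsto.const_mul (h3.add tendsto_const_nhds) (Or.inr ENNReal.coe_ne_top))
  rw [zero_add, zero_add] at hlim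
  refine ge_of_tendsto' hlim fun n => ?_
  have hm := (h1 n).1.continuous.aestronglyMeasurable (μ := volume)
  calc eLpNorm u (ENNReal.ofReal (hardySobolevExponent N 0)) volume
      = eLpNorm ((u - φ n) + φ n) (ENNReal.ofReal (hardySobolevExponent N 0)) volume := by simp
    _ ≤ eLpNorm (u - φ n) (ENNReal.ofReal (hardySobolevExponent N 0)) volume +
        eLpNorm (φ n) (ENNReal.ofReal (hardySobolevExponent N 0)) volume :=
        eLpNorm_add_le (h.memLp.1.sub hm) hm one_le_hardySobolevExponent_zero
    _ ≤ _ := by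
      rw [eLpNorm_sub_comm]
      gcongr
      refine (hsob _ (h1 n).1 (h1 n).2).trans ?_
      gcongr
      have hg := (continuous_gradient_of_contDiff (h1 n).1).aestronglyMeasurable (μ := volume)
      calc eLpNorm (∇ (φ n)) 2 volume = eLpNorm ((∇ (φ n) - G) + G) 2 volume := by simp
        _ ≤ _ := eLpNorm_add_le (hg.sub h.memLp_grad.1) h.memLp_grad.1 (by norm_num)

/-- Fundamental theorem of calculus along the segment from x to x + h. -/
theorem enorm_sub_le_lintegral_gradient {φ : EuclideanSpace ℝ (Fin N) → ℝ} (hφ : ContDiff ℝ ∞ φ)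
    (x h : EuclideanSpace ℝ (Fin N)) :
    ‖φ (x + h) - φ x‖ₑ ≤ ∫⁻ t in Set.Icc (0 : ℝ) 1, ‖h‖ₑ * ‖∇ φ (x + t • h)‖ₑ := by
  have hd : ∀ t : ℝ, HasDerivAt (fun t : ℝ => φ (x + t • h)) (fderiv ℝ φ (x + t • h) h) t := by
    intro t
    have h1 : HasDerivAt (fun t : ℝ => x + t • h) h t := by
      simpa using ((hasDerivAt_id t).smul_const h).const_add x
    exact (hφ.differentiable (by simp) (x + t • h)).hasFDerivAt.comp_hasDerivAt t h1
  have hc : ContDiff ℝ 1 fun t : ℝ => φ (x + t • h) := by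
    have : ContDiff ℝ ∞ fun t : ℝ => φ (x + t • h) := by fun_prop
    exact this.of_le (by simp)
  have := enorm_sub_le_lintegral_derivWithin_Icc_of_contDiffOn_Icc
    (f := fun t : ℝ => φ (x + t • h)) hc.contDiffOn zero_le_one
  simp only [one_smul, zero_smul, add_zero] at this
  refine this.trans (setLIntegral_mono' measurableSet_Icc fun t ht => ?_)
  rw [(hd t).hasDerivWithinAt.derivWithin (uniqueDiffOn_Icc zero_lt_one t ht), enorm_gradient,
    mul_comm]
  exact ContinuousLinearMap.le_opENorm _ _

/-- Square the segment bound, apply Cauchy–Schwarz on [0, 1], exchange the integrals and use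
translation invariance: every t contributes the same ‖∇φ‖_2^2. -/
theorem eLpNorm_translate_sub_le_of_contDiff {φ : EuclideanSpace ℝ (Fin N) → ℝ}
    (hφ : ContDiff ℝ ∞ φ) (h : EuclideanSpace ℝ (Fin N)) :
    eLpNorm (fun x => φ (x + h) - φ x) 2 volume ≤ ‖h‖ₑ * eLpNorm (∇ φ) 2 volume := by
  have hg := continuous_gradient_of_contDiff hφ
  rw [← ENNReal.pow_le_pow_left_iff (n := 2) (by norm_num), mul_pow, eLpNorm_two_sq,
    eLpNorm_two_sq]
  calc ∫⁻ x, ‖φ (x + h) - φ x‖ₑ ^ 2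
      ≤ ∫⁻ x, ∫⁻ t in Set.Icc (0 : ℝ) 1, ‖h‖ₑ ^ 2 * ‖∇ φ (x + t • h)‖ₑ ^ 2 := by
        refine lintegral_mono fun x => ?_
        have hm : Measurable fun t : ℝ => ‖h‖ₑ * ‖∇ φ (x + t • h)‖ₑ := by
          have : Continuous fun t : ℝ => ∇ φ (x + t • h) := by fun_prop
          exact this.measurable.enorm.const_mul _
        refine (pow_le_pow_left' (enorm_sub_le_lintegral_gradient hφ x h) 2).trans ?_
        refine (sq_lintegral_le hm.aemeasurable).trans_eq ?_
        simp [mul_pow]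
    _ = ∫⁻ t in Set.Icc (0 : ℝ) 1, ∫⁻ x, ‖h‖ₑ ^ 2 * ‖∇ φ (x + t • h)‖ₑ ^ 2 := by
        refine lintegral_lintegral_swap ?_
        have : Continuous fun z : EuclideanSpace ℝ (Fin N) × ℝ => ∇ φ (z.1 + z.2 • h) := by
          fun_prop
        exact ((this.measurable.enorm.pow_const 2).const_mul _).aemeasurable
    _ = ∫⁻ t in Set.Icc (0 : ℝ) 1, ‖h‖ₑ ^ 2 * ∫⁻ x, ‖∇ φ x‖ₑ ^ 2 := by
        refine lintegral_congr fun t => ?_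
        rw [lintegral_add_right_eq_self (fun x => ‖h‖ₑ ^ 2 * ‖∇ φ x‖ₑ ^ 2),
          lintegral_const_mul _ (hg.measurable.enorm.pow_const 2)]
    _ = _ := by simp

/-- The function u need not lie in L^2, so the approximants are not compared with it in that norm.
Convergence in L^q gives a subsequence converging almost everywhere, and Fatou's lemma passes the
bound for differences to the limit. -/
theorem HasDGradient.eLpNorm_translate_sub_le [Fact (3 ≤ N)] {u : EuclideanSpace ℝ (Fin N) → ℝ}
    {G : EuclideanSpace ℝ (Fin N) → EuclideanSpace ℝ (Fin N)} (hu : HasDGradient u G)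
    (h : EuclideanSpace ℝ (Fin N)) :
    eLpNorm (fun x => u (x + h) - u x) 2 volume ≤ ‖h‖ₑ * eLpNorm G 2 volume := by
  obtain ⟨φ, h1, h2, h3⟩ := hu.exists_approx
  have hm := fun n => (h1 n).1.continuous.aestronglyMeasurable (μ := volume)
  obtain ⟨ns, hns, hae⟩ := (tendstoInMeasure_of_tendsto_eLpNorm
    (one_pos.trans_le one_le_hardySobolevExponent_zero).ne' hm hu.memLp.1 h2).exists_seq_tendsto_ae
  have hae' : ∀ᵐ x, Tendsto (fun i => φ (ns i) (x + h)) atTop (𝓝 (u (x + h))) :=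
    (measurePreserving_add_right volume h).quasiMeasurePreserving.ae hae
  refine (Lp.eLpNorm_lim_le_liminf_eLpNorm (f := fun i x => φ (ns i) (x + h) - φ (ns i) x)
    (fun i => ?_) _ ?_).trans ?_
  · have := (h1 (ns i)).1.continuous
    exact Continuous.aestronglyMeasurable (by fun_prop)
  · filter_upwards [hae, hae'] with x hx hx' using hx'.sub hx
  have hlim : Tendsto (fun i => ‖h‖ₑ * (eLpNorm (∇ (φ (ns i)) - G) 2 volume + eLpNorm G 2 volume))
      atTop (𝓝 (‖h‖ₑ * (0 + eLpNorm G 2 volume))) :=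
    ENNReal.Tendsto.const_mul ((h3.comp hns.tendsto_atTop).add tendsto_const_nhds)
      (Or.inr enorm_ne_top)
  rw [zero_add] at hlim
  rw [← hlim.liminf_eq]
  refine liminf_le_liminf (Eventually.of_forall fun i => ?_)
  refine (eLpNorm_translate_sub_le_of_contDiff (h1 _).1 h).trans ?_
  gcongr
  have hg := (continuous_gradient_of_contDiff (h1 (ns i)).1).aestronglyMeasurable (μ := volume)
  calc eLpNorm (∇ (φ (ns i))) 2 volume = eLpNorm ((∇ (φ (ns i)) - G) + G) 2 volume := by simp
    _ ≤ _ := eLpNorm_add_le (hg.sub hu.memLp_grad.1) hu.memLp_grad.1 (by norm_num)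

end

/-! ### Pointwise interpolation and the bound on weighted integrals -/

theorem Real.rpow_mul_rpow_one_sub_le_add {a b θ : ℝ} (ha : 0 ≤ a) (hb : 0 ≤ b) (h0 : 0 ≤ θ)
    (h1 : θ ≤ 1) : a ^ θ * b ^ (1 - θ) ≤ a + b := by
  have h := Real.geom_mean_le_arith_mean2_weighted h0 (sub_nonneg.2 h1) ha hb (by ring)
  nlinarith

/-- The left side is the geometric mean, with weights p/q and 1 - p/q, of the two terms on the
right. Used near the origin. -/
theorem rpow_div_rpow_le_rpow_add_rpow_neg {t r p q s : ℝ} (ht : 0 ≤ t) (hr : 0 < r) (hp : 0 < p)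
    (hpq : p < q) : t ^ p / r ^ s ≤ t ^ q + r ^ (-(s * q / (q - p))) := by
  have hq : 0 < q := hp.trans hpq
  have hqp : q - p ≠ 0 := (sub_pos.2 hpq).ne'
  refine le_of_eq_of_le ?_ (Real.rpow_mul_rpow_one_sub_le_add (θ := p / q) (Real.rpow_nonneg ht q)
    (Real.rpow_nonneg hr.le _) (by positivity) ((div_le_one hq).2 hpq.le))
  rw [← Real.rpow_mul ht, ← Real.rpow_mul hr.le, mul_div_cancel₀ _ hq.ne', div_eq_mul_inv,
    ← Real.rpow_neg hr.le]
  congr 2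
  field_simp

/-- With a = (q - p) / (q - 2), one has p = 2 a + q (1 - a), so t^p / r^(σ a) is the geometric mean
of the two terms on the right with weights a and 1 - a. The hypothesis `h` reads σ a ≤ s, which lets
r ≥ 1 absorb the difference of weights. Used away from the origin. -/
theorem rpow_div_rpow_le_sq_div_add_rpow {t r p q s σ : ℝ} (ht : 0 ≤ t) (hr : 1 ≤ r) (hp : 2 ≤ p)
    (hpq : p < q) (h : σ * (q - p) ≤ s * (q - 2)) :
    t ^ p / r ^ s ≤ t ^ (2 : ℝ) / r ^ σ + t ^ q := by
  have hr0 : 0 < r := one_pos.trans_le hr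
  have hq2 : 0 < q - 2 := by linarith
  -- Adding exponents of t below requires t > 0.
  rcases ht.eq_or_lt with rfl | ht
  · rw [Real.zero_rpow (by linarith), zero_div]
    positivity
  set a := (q - p) / (q - 2) with ha
  have hle : t ^ p / r ^ s ≤ t ^ p / r ^ (σ * a) := by
    gcongr
    · rw [ha, ← mul_div_assoc, div_le_iff₀ hq2]
      exact h
  refine hle.trans (le_of_eq_of_le ?_ (Real.rpow_mul_rpow_one_sub_le_add (θ := a)
    (by positivity) (Real.rpow_nonneg ht.le q) (by rw [ha]; apply div_nonneg <;> linarith)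
    ((div_le_one hq2).2 (by linarith))))
  rw [Real.div_rpow (by positivity) (by positivity), ← Real.rpow_mul ht.le,
    ← Real.rpow_mul hr0.le, ← Real.rpow_mul ht.le, div_mul_eq_mul_div, ← Real.rpow_add ht]
  congr 2
  rw [ha]
  field_simp
  ring

section

variable {N : ℕ}

theorem lintegral_enorm_rpow_weightedVolume {p : ℝ} (hp : 0 ≤ p) (s : ℝ)
    (f : EuclideanSpace ℝ (Fin N) → ℝ) :
    ∫⁻ x, ‖f x‖ₑ ^ p ∂(weightedVolume N s) = ∫⁻ x, ENNReal.ofReal (|f x| ^ p / ‖x‖ ^ s) := by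
  rw [weightedVolume, lintegral_withDensity_eq_lintegral_mul_non_measurable _ (measurable_weight s)
    (Eventually.of_forall fun x => ENNReal.ofReal_lt_top)]
  refine lintegral_congr fun x => ?_
  have : 0 ≤ 1 / ‖x‖ ^ s := by positivity
  rw [Pi.mul_apply, ← ofReal_norm, Real.norm_eq_abs, ENNReal.ofReal_rpow_of_nonneg (abs_nonneg _) hp,
    ← ENNReal.ofReal_mul this]
  congr 1
  ring

theorem weightedVolume_zero (N : ℕ) : weightedVolume N 0 = volume := by
  simp [weightedVolume]

theorem eLpNorm_weightedVolume_rpow {p : ℝ} (hp : 0 < p) (s : ℝ)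
    (f : EuclideanSpace ℝ (Fin N) → ℝ) :
    eLpNorm f (ENNReal.ofReal p) (weightedVolume N s) ^ p =
      ∫⁻ x, ENNReal.ofReal (|f x| ^ p / ‖x‖ ^ s) := by
  rw [← lintegral_enorm_rpow_weightedVolume hp.le]
  have := eLpNorm_nnreal_pow_eq_lintegral (f := f) (μ := weightedVolume N s)
    (Real.toNNReal_pos.2 hp).ne'
  rwa [Real.coe_toNNReal _ hp.le] at this

theorem eLpNorm_rpow_eq_lintegral_ofReal {p : ℝ} (hp : 0 < p)
    (f : EuclideanSpace ℝ (Fin N) → ℝ) :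
    eLpNorm f (ENNReal.ofReal p) volume ^ p = ∫⁻ x, ENNReal.ofReal (|f x| ^ p) := by
  have := eLpNorm_weightedVolume_rpow hp 0 f
  simpa [weightedVolume_zero] using this

/-- Polar coordinates reduce this to the integrability of y^(N - 1 - a) on (0, 1). -/
theorem setLIntegral_ball_norm_rpow_neg_lt_top [hN : Fact (3 ≤ N)] {a : ℝ} (ha : a < N) :
    ∫⁻ x in Metric.ball (0 : EuclideanSpace ℝ (Fin N)) 1, ENNReal.ofReal (‖x‖ ^ (-a)) < ⊤ := by
  have : Nonempty (Fin N) := ⟨⟨0, by have := hN.out; omega⟩⟩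
  have hN1 : 1 ≤ N := by have := hN.out; omega
  have hi : IntegrableOn (fun x : EuclideanSpace ℝ (Fin N) => ‖x‖ ^ (-a)) (Metric.ball 0 1) := by
    refine (integrableOn_fun_norm_addHaar volume (f := fun y : ℝ => y ^ (-a)) (r := 1)).2 ?_
    have h1 : IntegrableOn (fun y : ℝ => y ^ ((N : ℝ) - 1 - a)) (Set.Ioo 0 1) :=
      (intervalIntegral.integrableOn_Ioo_rpow_iff one_pos).2 (by linarith)
    refine h1.congr_fun (fun y hy => ?_) measurableSet_Ioo
    simp only [finrank_euclideanSpace, Fintype.card_fin, smul_eq_mul]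
    rw [← Real.rpow_natCast, ← Real.rpow_add hy.1, Nat.cast_sub hN1, Nat.cast_one]
    rfl
  exact hi.lintegral_lt_top

namespace ESpace

variable [Fact (3 ≤ N)] {σ : ℝ}

theorem norm_eq_sqrt (u : ESpace N σ) : ‖u‖ = √(‖u.hasDGradient.memLp_grad.toLp _‖ ^ 2 +
      ‖u.memLp_weighted.toLp _‖ ^ 2) :=
  (energyNorm_eq u).trans (WithLp.prod_norm_eq_of_L2 _)

theorem eLpNorm_grad_le (u : ESpace N σ) : eLpNorm u.grad 2 volume ≤ ‖u‖ₑ := by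
  rw [← Lp.enorm_toLp (hf := u.hasDGradient.memLp_grad), enorm_le_iff_norm_le, norm_eq_sqrt]
  exact Real.le_sqrt_of_sq_le (le_add_of_nonneg_right (sq_nonneg _))

theorem eLpNorm_weighted_le (u : ESpace N σ) :
    eLpNorm u.toFun 2 (weightedVolume N σ) ≤ ‖u‖ₑ := by
  rw [← Lp.enorm_toLp (hf := u.memLp_weighted), enorm_le_iff_norm_le, norm_eq_sqrt]
  exact Real.le_sqrt_of_sq_le (le_add_of_nonneg_left (sq_nonneg _))

theorem stronglyMeasurable (u : ESpace N σ) : StronglyMeasurable u.toFun :=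
  AEEqFun.stronglyMeasurable u.1

theorem exists_eLpNorm_le (N : ℕ) [Fact (3 ≤ N)] (σ : ℝ) : ∃ C : NNReal, ∀ u : ESpace N σ,
    eLpNorm u.toFun (ENNReal.ofReal (hardySobolevExponent N 0)) volume ≤ C * ‖u‖ₑ := by
  obtain ⟨C, hC⟩ := exists_eLpNorm_le_of_hasDGradient N
  exact ⟨C, fun u => (hC _ _ u.hasDGradient).trans (by gcongr; exact u.eLpNorm_grad_le)⟩

/-- The quantitative core of both assertions. No sign is imposed on s: compactness applies this with
s - η, which is negative when s < η. -/
theorem exists_lintegral_rpow_div_le {p s : ℝ} (hp : 2 ≤ p) (hpq : p < hardySobolevExponent N 0)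
    (hout : σ * (hardySobolevExponent N 0 - p) ≤ s * (hardySobolevExponent N 0 - 2))
    (hin : s * hardySobolevExponent N 0 < N * (hardySobolevExponent N 0 - p)) (ρ : NNReal) :
    ∃ K : NNReal, ∀ u : ESpace N σ, ‖u‖ₑ ≤ ρ →
      ∫⁻ x, ENNReal.ofReal (|u.toFun x| ^ p / ‖x‖ ^ s) ≤ K := by
  have : Nonempty (Fin N) := ⟨⟨0, by have := Fact.out (p := 3 ≤ N); omega⟩⟩
  set q := hardySobolevExponent N 0 with hq
  have hq0 : 0 < q := by linarith
  set a := s * q / (q - p) with ha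
  have haN : a < N := (div_lt_iff₀ (sub_pos.2 hpq)).2 hin
  obtain ⟨C, hC⟩ := exists_eLpNorm_le N σ
  set I := ∫⁻ x in Metric.ball (0 : EuclideanSpace ℝ (Fin N)) 1, ENNReal.ofReal (‖x‖ ^ (-a))
  have hI : I < ⊤ := setLIntegral_ball_norm_rpow_neg_lt_top haN
  suffices hK : ∀ u : ESpace N σ, ‖u‖ₑ ≤ ρ →
      ∫⁻ x, ENNReal.ofReal (|u.toFun x| ^ p / ‖x‖ ^ s) ≤
        (C * ρ : ℝ≥0∞) ^ q + (ρ : ℝ≥0∞) ^ (2 : ℝ) + I by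
    have hfin : (C * ρ : ℝ≥0∞) ^ q + (ρ : ℝ≥0∞) ^ (2 : ℝ) + I ≠ ⊤ := by
      refine ENNReal.add_ne_top.2 ⟨ENNReal.add_ne_top.2 ⟨?_, ?_⟩, hI.ne⟩
      · exact ENNReal.rpow_ne_top_of_nonneg hq0.le (by finiteness)
      · exact ENNReal.rpow_ne_top_of_nonneg (by norm_num) (by finiteness)
    exact ⟨_, fun u hu => (hK u hu).trans_eq (ENNReal.coe_toNNReal hfin).symm⟩
  intro u hu
  have hum : Measurable u.toFun := u.stronglyMeasurable.measurable
  calc ∫⁻ x, ENNReal.ofReal (|u.toFun x| ^ p / ‖x‖ ^ s)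
      ≤ ∫⁻ x, (ENNReal.ofReal (|u.toFun x| ^ q) + ENNReal.ofReal (|u.toFun x| ^ (2 : ℝ) / ‖x‖ ^ σ)
          + (Metric.ball 0 1).indicator (fun x => ENNReal.ofReal (‖x‖ ^ (-a))) x) := by
        refine lintegral_mono_ae ?_
        filter_upwards [Measure.ae_ne volume (0 : EuclideanSpace ℝ (Fin N))] with x hx
        by_cases hx1 : x ∈ Metric.ball 0 1
        · rw [Set.indicator_of_mem hx1]
          calc ENNReal.ofReal (|u.toFun x| ^ p / ‖x‖ ^ s)
              ≤ ENNReal.ofReal (|u.toFun x| ^ q + ‖x‖ ^ (-a)) :=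
                ENNReal.ofReal_le_ofReal (rpow_div_rpow_le_rpow_add_rpow_neg (abs_nonneg _)
                  (norm_pos_iff.2 hx) (by linarith) hpq)
            _ ≤ ENNReal.ofReal (|u.toFun x| ^ q) + ENNReal.ofReal (‖x‖ ^ (-a)) :=
                ENNReal.ofReal_add_le
            _ ≤ _ := by gcongr; exact le_self_add
        · rw [Set.indicator_of_notMem hx1, add_zero]
          have hx1 : 1 ≤ ‖x‖ := by simpa using hx1
          calc ENNReal.ofReal (|u.toFun x| ^ p / ‖x‖ ^ s)
              ≤ ENNReal.ofReal (|u.toFun x| ^ (2 : ℝ) / ‖x‖ ^ σ + |u.toFun x| ^ q) :=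
                ENNReal.ofReal_le_ofReal (rpow_div_rpow_le_sq_div_add_rpow (abs_nonneg _)
                  hx1 hp hpq hout)
            _ ≤ _ := by rw [add_comm (ENNReal.ofReal _)]; exact ENNReal.ofReal_add_le
    _ = (∫⁻ x, ENNReal.ofReal (|u.toFun x| ^ q))
          + (∫⁻ x, ENNReal.ofReal (|u.toFun x| ^ (2 : ℝ) / ‖x‖ ^ σ)) + I := by
        rw [lintegral_add_left (by fun_prop), lintegral_add_left (by fun_prop),
          lintegral_indicator Metric.isOpen_ball.measurableSet]
    _ ≤ _ := by
        rw [← eLpNorm_rpow_eq_lintegral_ofReal hq0, ← eLpNorm_weightedVolume_rpow two_pos]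
        gcongr
        · exact (hC u).trans (by gcongr)
        · rw [ENNReal.ofReal_ofNat]
          exact u.eLpNorm_weighted_le.trans hu

end ESpace

end

/-! ### Local L^2 control by averages over small balls -/

theorem ENNReal.add_sq_le_two_mul (a b : ℝ≥0∞) : (a + b) ^ 2 ≤ 2 * (a ^ 2 + b ^ 2) := by
  have := ENNReal.rpow_add_le_mul_rpow_add_rpow a b (p := 2) (by norm_num)
  norm_num at this
  exact this

section

variable {N : ℕ}

/-- Integrate w(x) = w(y) - (w(y) - w(x)) over y in the ball. Since x lies in the ball around c of
radius l, that ball sits in the one around x of radius 2 l, so the error is an integral of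
differences over translations h with |h| < 2 l. -/
theorem enorm_mul_volume_ball_le {w : EuclideanSpace ℝ (Fin N) → ℝ} {c x : EuclideanSpace ℝ (Fin N)}
    {l : ℝ} (hw : IntegrableOn w (Metric.ball c l)) (hx : x ∈ Metric.ball c l) :
    ‖w x‖ₑ * volume (Metric.ball (0 : EuclideanSpace ℝ (Fin N)) l) ≤
      ‖∫ y in Metric.ball c l, w y‖ₑ + ∫⁻ h in Metric.ball 0 (2 * l), ‖w (x + h) - w x‖ₑ := by
  have hc : IntegrableOn (fun _ => w x) (Metric.ball c l) :=
    integrableOn_const measure_ball_lt_top.ne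
  have hV : volume.real (Metric.ball c l) * w x =
      (∫ y in Metric.ball c l, w y) - ∫ y in Metric.ball c l, (w y - w x) := by
    rw [integral_sub hw hc, setIntegral_const, smul_eq_mul]
    ring
  have hsub : Metric.ball c l ⊆ Metric.ball x (2 * l) :=
    Metric.ball_subset_ball' (by rw [dist_comm]; linarith [Metric.mem_ball.1 hx])
  have hpre : (fun h => x + h) ⁻¹' Metric.ball x (2 * l) = Metric.ball 0 (2 * l) := by
    simp
  calc ‖w x‖ₑ * volume (Metric.ball (0 : EuclideanSpace ℝ (Fin N)) l)
      = ‖volume.real (Metric.ball c l) * w x‖ₑ := by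
        rw [enorm_mul, mul_comm, Real.enorm_of_nonneg measureReal_nonneg,
          ofReal_measureReal measure_ball_lt_top.ne, ← Measure.addHaar_ball_center volume c l]
    _ ≤ ‖∫ y in Metric.ball c l, w y‖ₑ + ‖∫ y in Metric.ball c l, (w y - w x)‖ₑ := by
        rw [hV]; exact enorm_sub_le
    _ ≤ ‖∫ y in Metric.ball c l, w y‖ₑ + ∫⁻ y in Metric.ball x (2 * l), ‖w y - w x‖ₑ := by
        gcongr
        exact (enorm_integral_le_lintegral_enorm _).trans (lintegral_mono_set hsub)
    _ = _ := by
        rw [← hpre, (measurePreserving_add_left volume x).setLIntegral_comp_preimage_emb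
          (measurableEmbedding_addLeft x) (fun y => ‖w y - w x‖ₑ)]

theorem HasDGradient.integrableOn_ball [Fact (3 ≤ N)] {u : EuclideanSpace ℝ (Fin N) → ℝ}
    {G : EuclideanSpace ℝ (Fin N) → EuclideanSpace ℝ (Fin N)} (hu : HasDGradient u G)
    (c : EuclideanSpace ℝ (Fin N)) (l : ℝ) : IntegrableOn u (Metric.ball c l) :=
  ((hu.memLp.locallyIntegrable one_le_hardySobolevExponent_zero).integrableOn_isCompact
    (isCompact_closedBall c l)).mono_set Metric.ball_subset_closedBall

/-- A function in `D_0^{1,2}(ℝ^N)` is controlled in `L²(A)` by its averages over small balls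
covering `A`, up to a multiple of the radius. -/
theorem HasDGradient.setLIntegral_sq_le [Fact (3 ≤ N)] {u : EuclideanSpace ℝ (Fin N) → ℝ}
    {G : EuclideanSpace ℝ (Fin N) → EuclideanSpace ℝ (Fin N)} (hu : HasDGradient u G)
    (hum : Measurable u) {A S : Set (EuclideanSpace ℝ (Fin N))} (hA : MeasurableSet A)
    {l : ℝ} (hl : 0 < l) (hAS : A ⊆ ⋃ c ∈ S, Metric.ball c l) {δ : ℝ≥0∞}
    (hδ : ∀ c ∈ S, ‖∫ y in Metric.ball c l, u y‖ₑ ≤ δ) :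
    ∫⁻ x in A, ‖u x‖ₑ ^ 2 ≤
      2 * δ ^ 2 * volume A / volume (Metric.ball (0 : EuclideanSpace ℝ (Fin N)) l) ^ 2 +
      2 * (2 ^ N) ^ 2 * (ENNReal.ofReal (2 * l) * eLpNorm G 2 volume) ^ 2 := by
  set V := volume (Metric.ball (0 : EuclideanSpace ℝ (Fin N)) l) with hV
  have hV0 : V ≠ 0 := (Metric.measure_ball_pos volume _ hl).ne'
  have hVt : V ≠ ⊤ := measure_ball_lt_top.ne
  have hV2 : volume (Metric.ball (0 : EuclideanSpace ℝ (Fin N)) (2 * l)) = 2 ^ N * V := by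
    rw [Measure.addHaar_ball_mul_of_pos _ _ two_pos]
    simp [hV, ENNReal.ofReal_pow]
  have hmd : Measurable fun z : EuclideanSpace ℝ (Fin N) × EuclideanSpace ℝ (Fin N) =>
      ‖u (z.1 + z.2) - u z.1‖ₑ := by fun_prop
  have hpt : ∀ x ∈ A, V ^ 2 * ‖u x‖ₑ ^ 2 ≤ 2 * δ ^ 2 +
      2 * (2 ^ N * V * ∫⁻ h in Metric.ball 0 (2 * l), ‖u (x + h) - u x‖ₑ ^ 2) := by
    intro x hx
    obtain ⟨c, hc, hxc⟩ := Set.mem_iUnion₂.1 (hAS hx)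
    have h1 := enorm_mul_volume_ball_le (hu.integrableOn_ball c l) hxc
    have h2 : (∫⁻ h in Metric.ball 0 (2 * l), ‖u (x + h) - u x‖ₑ) ^ 2 ≤
        2 ^ N * V * ∫⁻ h in Metric.ball 0 (2 * l), ‖u (x + h) - u x‖ₑ ^ 2 := by
      have := sq_lintegral_le (μ := volume.restrict (Metric.ball 0 (2 * l)))
        (f := fun h => ‖u (x + h) - u x‖ₑ) (by fun_prop)
      rwa [Measure.restrict_apply_univ, hV2] at this
    calc V ^ 2 * ‖u x‖ₑ ^ 2 = (‖u x‖ₑ * V) ^ 2 := by ring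
      _ ≤ (δ + ∫⁻ h in Metric.ball 0 (2 * l), ‖u (x + h) - u x‖ₑ) ^ 2 := by
        gcongr
        exact h1.trans (by gcongr; exact hδ c hc)
      _ ≤ 2 * (δ ^ 2 + (∫⁻ h in Metric.ball 0 (2 * l), ‖u (x + h) - u x‖ₑ) ^ 2) :=
        ENNReal.add_sq_le_two_mul _ _
      _ ≤ _ := by rw [mul_add]; gcongr
  -- After exchanging the integrals, each h with |h| < 2 l is handled by the translation estimate.
  have hdouble : ∫⁻ x in A, ∫⁻ h in Metric.ball 0 (2 * l), ‖u (x + h) - u x‖ₑ ^ 2 ≤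
      2 ^ N * V * (ENNReal.ofReal (2 * l) * eLpNorm G 2 volume) ^ 2 := by
    rw [lintegral_lintegral_swap (hmd.pow_const 2).aemeasurable, ← hV2,
      mul_comm (volume _),
      ← setLIntegral_const]
    refine setLIntegral_mono' Metric.isOpen_ball.measurableSet fun h hh => ?_
    refine (setLIntegral_le_lintegral A _).trans ?_
    rw [← eLpNorm_two_sq]
    gcongr
    refine (hu.eLpNorm_translate_sub_le h).trans ?_
    gcongr
    rw [← ofReal_norm]
    exact ENNReal.ofReal_le_ofReal (by simpa using (Metric.mem_ball.1 hh).le)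
  have hmain : V ^ 2 * ∫⁻ x in A, ‖u x‖ₑ ^ 2 ≤ 2 * δ ^ 2 * volume A +
      2 * (2 ^ N * V * (2 ^ N * V * (ENNReal.ofReal (2 * l) * eLpNorm G 2 volume) ^ 2)) := by
    rw [← lintegral_const_mul _ (by fun_prop)]
    refine (setLIntegral_mono' hA hpt).trans ?_
    rw [lintegral_add_left measurable_const, setLIntegral_const,
      lintegral_const_mul' _ _ (by finiteness), lintegral_const_mul' _ _ (by finiteness)]
    gcongr
  rw [mul_comm, ← ENNReal.le_div_iff_mul_le (Or.inl (by positivity)) (Or.inl (by finiteness)),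
    ENNReal.add_div] at hmain
  refine hmain.trans_eq ?_
  congr 1
  -- One volume factor comes from Cauchy–Schwarz and one from integrating over h; together they
  -- cancel V^2, so this term is of order l^2, with a constant independent of the size of A.
  rw [show ∀ a b : ℝ≥0∞, 2 * (a * V * (a * V * b)) = 2 * a ^ 2 * b * V ^ 2 by intros; ring,
    ENNReal.mul_div_cancel_right (by positivity) (by finiteness)]

namespace ESpace

variable [Fact (3 ≤ N)] {σ : ℝ}

/-- The order of choices matters: l makes the gradient term at most ε/2 on the ball of radius ρ,
then S is a finite l-net for the ball of radius L, and δ comes last because the averages are divided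
by the volume of a ball of radius l. -/
theorem exists_averages_control (N : ℕ) [Fact (3 ≤ N)] (σ : ℝ) (L : ℝ) (ρ : NNReal) {ε : ℝ≥0∞}
    (hε : ε ≠ 0) :
    ∃ l > 0, ∃ S : Set (EuclideanSpace ℝ (Fin N)), S.Finite ∧ ∃ δ > 0, ∀ u : ESpace N σ,
      ‖u‖ₑ ≤ ρ → (∀ c ∈ S, ‖∫ y in Metric.ball c l, u.toFun y‖ ≤ δ) →
      ∫⁻ x in Metric.ball 0 L, ‖u.toFun x‖ₑ ^ 2 ≤ ε := by
  have hε2 : 0 < ε / 2 := ENNReal.half_pos hε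
  obtain ⟨l, hl2, hl⟩ : ∃ l : ℝ, 2 * (2 ^ N) ^ 2 * (ENNReal.ofReal (2 * l) * ρ) ^ 2 < ε / 2 ∧
      0 < l := by
    have hc : Continuous fun l : ℝ =>
        2 * (2 ^ N) ^ 2 * (ENNReal.ofReal (2 * l) * (ρ : ℝ≥0∞)) ^ 2 := by
      refine (ENNReal.continuous_const_mul (by finiteness)).comp
        ((ENNReal.continuous_pow 2).comp ((ENNReal.continuous_mul_const (by finiteness)).comp
        (ENNReal.continuous_ofReal.comp (by fun_prop))))
    have ht := (hc.tendsto 0).eventually_lt_const (u := ε / 2) (by simpa using hε2)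
    exact ((ht.filter_mono nhdsWithin_le_nhds).and
      (self_mem_nhdsWithin (s := Set.Ioi (0 : ℝ)))).exists
  obtain ⟨S, -, hSf, hS⟩ := Metric.finite_approx_of_totallyBounded
    ((isCompact_closedBall (0 : EuclideanSpace ℝ (Fin N)) L).totallyBounded) l hl
  set V := volume (Metric.ball (0 : EuclideanSpace ℝ (Fin N)) l) with hV
  have hV0 : V ≠ 0 := (Metric.measure_ball_pos volume _ hl).ne'
  set A := Metric.ball (0 : EuclideanSpace ℝ (Fin N)) L
  have hA : volume A ≠ ⊤ := measure_ball_lt_top.ne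
  obtain ⟨δ, hδ2, hδ⟩ : ∃ δ : ℝ, 2 * ENNReal.ofReal δ ^ 2 * volume A / V ^ 2 < ε / 2 ∧
      0 < δ := by
    have hc : Continuous fun δ : ℝ => 2 * ENNReal.ofReal δ ^ 2 * volume A / V ^ 2 := by
      simp only [div_eq_mul_inv]
      refine (ENNReal.continuous_mul_const (ENNReal.inv_ne_top.2 (by positivity))).comp
        ((ENNReal.continuous_mul_const hA).comp ((ENNReal.continuous_const_mul (by finiteness)).comp
        ((ENNReal.continuous_pow 2).comp ENNReal.continuous_ofReal)))
    have ht := (hc.tendsto 0).eventually_lt_const (u := ε / 2) (by simpa using hε2)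
    exact ((ht.filter_mono nhdsWithin_le_nhds).and
      (self_mem_nhdsWithin (s := Set.Ioi (0 : ℝ)))).exists
  refine ⟨l, hl, S, hSf, δ, hδ, fun u hu huS => ?_⟩
  have h := u.hasDGradient.setLIntegral_sq_le u.stronglyMeasurable.measurable
    Metric.isOpen_ball.measurableSet hl (A := A) (Metric.ball_subset_closedBall.trans hS)
    (δ := ENNReal.ofReal δ) fun c hc => by
      rw [← ofReal_norm]; exact ENNReal.ofReal_le_ofReal (huS c hc)
  calc ∫⁻ x in A, ‖u.toFun x‖ₑ ^ 2
      ≤ ε / 2 + 2 * (2 ^ N) ^ 2 * (ENNReal.ofReal (2 * l) * ρ) ^ 2 := by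
        refine h.trans ?_
        gcongr
        exact u.eLpNorm_grad_le.trans hu
    _ ≤ ε / 2 + ε / 2 := by gcongr
    _ = ε := ENNReal.add_halves ε

end ESpace

end

/-! ### Criterion for compactness -/

/-- An operator is compact if, on a ball, it is small wherever finitely many suitable continuous
linear functionals are small. -/
theorem isCompactOperator_of_finite_functionals {E F : Type*} [NormedAddCommGroup E]
    [NormedSpace ℝ E] [NormedAddCommGroup F] [NormedSpace ℝ F] [CompleteSpace F] (T : E →L[ℝ] F)
    (h : ∀ ε > 0, ∃ S : Set (E →L[ℝ] ℝ), S.Finite ∧ ∃ δ > 0, ∀ w, ‖w‖ ≤ 2 →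
      (∀ φ ∈ S, ‖φ w‖ ≤ δ) → ‖T w‖ ≤ ε) : IsCompactOperator T := by
  refine (isCompactOperator_iff_isCompact_closure_image_closedBall (T : E →ₗ[ℝ] F) one_pos).2 ?_
  refine TotallyBounded.isCompact_of_isClosed (TotallyBounded.closure ?_) isClosed_closure
  refine Metric.totallyBounded_iff.2 fun ε hε => ?_
  obtain ⟨S, hS, δ, hδ, hw⟩ := h (ε / 2) (half_pos hε)
  have : Fintype S := hS.fintype
  -- The functionals in S map the unit ball to a bounded set in finite dimension, which has a finite
  -- δ-net with centres in the image. Preimages of the centres give the ε-net for T; differences of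
  -- two points of the unit ball have norm at most 2, whence the 2 in the hypothesis.
  let Φ : E →L[ℝ] (S → ℝ) := ContinuousLinearMap.pi fun φ => φ.1
  have hb : TotallyBounded (Φ '' Metric.closedBall 0 1) :=
    (Φ.lipschitz.isBounded_image Metric.isBounded_closedBall).isCompact_closure.totallyBounded.subset
      subset_closure
  obtain ⟨t, ht, htf, hcov⟩ := Set.exists_subset_image_finite_and.1
    (Metric.finite_approx_of_totallyBounded hb δ hδ)
  refine ⟨T '' t, htf.image T, ?_⟩
  rintro _ ⟨u, hu, rfl⟩
  obtain ⟨_, ⟨v, hv, rfl⟩, huv⟩ := Set.mem_iUnion₂.1 (hcov (Set.mem_image_of_mem Φ hu))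
  refine Set.mem_iUnion₂.2 ⟨T v, Set.mem_image_of_mem T hv, ?_⟩
  have hv1 := ht hv
  rw [mem_closedBall_zero_iff] at hu hv1
  rw [Metric.mem_ball, dist_eq_norm, ← map_sub] at huv
  change dist (T u) (T v) < ε
  rw [dist_eq_norm, ← map_sub]
  refine (hw (u - v) ((norm_sub_le _ _).trans (by linarith)) fun φ hφ => ?_).trans_lt
    (half_lt_self hε)
  exact (norm_le_pi_norm (Φ (u - v)) ⟨φ, hφ⟩).trans huv.le

/-! ### Smallness of the extreme regions, and compactness estimate -/

/-- Four regions. Where r ≤ 1/L, r ≥ L or t ≥ L, respectively r^η, r^(-η) or t^(-η) is at most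
L^(-η), and this factor is split off at the price of a perturbed exponent. In the remaining region
t^p ≤ L^(p - 2) t^2 and r^(-s) ≤ L^s. -/
theorem rpow_div_rpow_le_of_one_le {t r p s η L : ℝ} (ht : 0 ≤ t) (hr : 0 < r) (hp : 2 ≤ p)
    (hs : 0 ≤ s) (hη : 0 < η) (hL : 1 ≤ L) :
    t ^ p / r ^ s ≤ L ^ (-η) * (t ^ p / r ^ (s + η) + t ^ p / r ^ (s - η) + t ^ (p + η) / r ^ s) +
      (if r < L then L ^ (p - 2 + s) * t ^ 2 else 0) := by
  have hL0 : 0 < L := one_pos.trans_le hL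
  have hX : 0 ≤ t ^ p / r ^ (s + η) := by positivity
  have hY : 0 ≤ t ^ p / r ^ (s - η) := by positivity
  have hZ : 0 ≤ t ^ (p + η) / r ^ s := by positivity
  have hI : 0 ≤ if r < L then L ^ (p - 2 + s) * t ^ 2 else 0 := by split_ifs <;> positivity
  have hLη : 0 ≤ L ^ (-η) := by positivity
  have key : ∀ a, t ^ p / r ^ s ≤ L ^ (-η) * a →
      a ≤ t ^ p / r ^ (s + η) + t ^ p / r ^ (s - η) + t ^ (p + η) / r ^ s →
      t ^ p / r ^ s ≤ L ^ (-η) * (t ^ p / r ^ (s + η) + t ^ p / r ^ (s - η) + t ^ (p + η) / r ^ s) +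
      (if r < L then L ^ (p - 2 + s) * t ^ 2 else 0) := fun a h1 h2 =>
    h1.trans ((mul_le_mul_of_nonneg_left h2 hLη).trans (le_add_of_nonneg_right hI))
  by_cases h1 : r ≤ L⁻¹
  · refine key _ ?_ (show t ^ p / r ^ (s + η) ≤ _ by linarith)
    have : r ^ η ≤ L ^ (-η) := by
      rw [Real.rpow_neg hL0.le, ← Real.inv_rpow hL0.le]
      gcongr
    calc t ^ p / r ^ s = r ^ η * (t ^ p / r ^ (s + η)) := by
          rw [Real.rpow_add hr]; field_simp
      _ ≤ _ := by gcongr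
  by_cases h2 : r < L
  swap
  · refine key _ ?_ (show t ^ p / r ^ (s - η) ≤ _ by linarith)
    have : r ^ (-η) ≤ L ^ (-η) :=
      Real.rpow_le_rpow_of_nonpos hL0 (not_lt.1 h2) (by linarith)
    calc t ^ p / r ^ s = r ^ (-η) * (t ^ p / r ^ (s - η)) := by
          rw [Real.rpow_sub hr, Real.rpow_neg hr.le]; field_simp
      _ ≤ _ := by gcongr
  by_cases h3 : t < L
  swap
  · refine key _ ?_ (show t ^ (p + η) / r ^ s ≤ _ by linarith)
    have ht0 : 0 < t := hL0.trans_le (not_lt.1 h3)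
    have : t ^ (-η) ≤ L ^ (-η) :=
      Real.rpow_le_rpow_of_nonpos hL0 (not_lt.1 h3) (by linarith)
    calc t ^ p / r ^ s = t ^ (-η) * (t ^ (p + η) / r ^ s) := by
          rw [Real.rpow_add ht0, Real.rpow_neg ht0.le]; field_simp
      _ ≤ _ := by gcongr
  rw [if_pos h2]
  refine le_add_of_nonneg_of_le (by positivity) ?_
  have hrs : (r ^ s)⁻¹ ≤ L ^ s := by
    rw [← Real.inv_rpow hr.le]
    exact Real.rpow_le_rpow (by positivity) (inv_le_of_inv_le₀ hL0 (not_le.1 h1).le) hs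
  have htp : t ^ p ≤ L ^ (p - 2) * t ^ 2 := by
    rcases ht.eq_or_lt with rfl | ht0
    · rw [Real.zero_rpow (by linarith)]; positivity
    · calc t ^ p = t ^ (p - 2) * t ^ 2 := by
            rw [← Real.rpow_natCast, ← Real.rpow_add ht0]; norm_num
        _ ≤ _ := by gcongr
  calc t ^ p / r ^ s = t ^ p * (r ^ s)⁻¹ := div_eq_mul_inv _ _
    _ ≤ (L ^ (p - 2) * t ^ 2) * L ^ s := by gcongr
    _ = _ := by rw [Real.rpow_add hL0]; ring

section

variable {N : ℕ}

namespace ESpace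

variable [Fact (3 ≤ N)] {σ : ℝ}

/-- Integration over a ball, as a continuous linear functional on `E`. -/
theorem exists_ballIntegral (c : EuclideanSpace ℝ (Fin N)) (l : ℝ) :
    ∃ φ : ESpace N σ →L[ℝ] ℝ, ∀ u : ESpace N σ, φ u = ∫ y in Metric.ball c l, u.toFun y := by
  obtain ⟨C, hC⟩ := exists_eLpNorm_le N σ
  set q := ENNReal.ofReal (hardySobolevExponent N 0) with hq
  -- The Hölder factor for passing from L^q to L^1 on the ball.
  set D := volume (Metric.ball c l) ^ (1 / (1 : ℝ≥0∞).toReal - 1 / q.toReal) with hD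
  have hDt : D ≠ ⊤ := by
    refine ENNReal.rpow_ne_top_of_nonneg ?_ measure_ball_lt_top.ne
    have h2 := two_lt_hardySobolevExponent_zero (N := N)
    rw [hq, ENNReal.toReal_ofReal (by linarith), ENNReal.toReal_one, sub_nonneg]
    exact one_div_le_one_div_of_le one_pos (by linarith)
  have hi := fun u : ESpace N σ => u.hasDGradient.integrableOn_ball c l
  let φ : ESpace N σ →ₗ[ℝ] ℝ :=
    { toFun := fun u => ∫ y in Metric.ball c l, u.toFun y
      map_add' := fun u v => by
        rw [integral_congr_ae (ae_restrict_of_ae (toFun_add u v))]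
        exact integral_add (hi u) (hi v)
      map_smul' := fun a u => by
        rw [integral_congr_ae (ae_restrict_of_ae (toFun_smul a u))]
        exact integral_smul a _ }
  refine ⟨φ.mkContinuous (C * D.toReal) fun u => ?_, fun u => rfl⟩
  have h : ‖φ u‖ₑ ≤ C * ‖u‖ₑ * D := by
    refine (enorm_integral_le_lintegral_enorm _).trans ?_
    rw [← eLpNorm_one_eq_lintegral_enorm]
    refine (eLpNorm_le_eLpNorm_mul_rpow_measure_univ (one_le_hardySobolevExponent_zero (N := N))
      u.hasDGradient.memLp.1.restrict).trans ?_
    rw [Measure.restrict_apply_univ]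
    gcongr
    exact (eLpNorm_mono_measure _ Measure.restrict_le_self).trans (hC u)
  have h' := ENNReal.toReal_mono (by finiteness) h
  simp only [ENNReal.toReal_mul, toReal_enorm, ENNReal.coe_toReal] at h'
  linarith

end ESpace

end

namespace ESpace

variable {N : ℕ} [Fact (3 ≤ N)] {σ : ℝ}

/-- Strictness of `hout` provides the room to perturb s downwards; the perturbations of s upwards
and of p use only `hin` and p < q, which are already strict. -/
theorem exists_finite_functionals_control {p s : ℝ} (hσ : 0 ≤ σ) (hs : 0 ≤ s) (hp : 2 ≤ p)
    (hpq : p < hardySobolevExponent N 0)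
    (hout : σ * (hardySobolevExponent N 0 - p) < s * (hardySobolevExponent N 0 - 2))
    (hin : s * hardySobolevExponent N 0 < N * (hardySobolevExponent N 0 - p))
    {ε : ℝ≥0∞} (hε : ε ≠ 0) :
    ∃ S : Set (ESpace N σ →L[ℝ] ℝ), S.Finite ∧ ∃ δ > 0, ∀ u : ESpace N σ, ‖u‖ ≤ 2 →
      (∀ φ ∈ S, ‖φ u‖ ≤ δ) → ∫⁻ x, ENNReal.ofReal (|u.toFun x| ^ p / ‖x‖ ^ s) ≤ ε := by
  have : Nonempty (Fin N) := ⟨⟨0, by have := Fact.out (p := 3 ≤ N); omega⟩⟩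
  set q := hardySobolevExponent N 0 with hq
  -- Finitely many strict inequalities hold at η = 0 and are continuous in η, so they persist for
  -- some η > 0.
  obtain ⟨η, ⟨h1, h2, h3, h4⟩, hη⟩ : ∃ η : ℝ, (p + η < q ∧ σ * (q - p) < (s - η) * (q - 2) ∧
      (s + η) * q < N * (q - p) ∧ s * q < N * (q - (p + η))) ∧ 0 < η := by
    have ev : ∀ f : ℝ → ℝ, ∀ c, Continuous f → f 0 < c → ∀ᶠ η in 𝓝[>] (0 : ℝ), f η < c :=
      fun f c hf h0 => ((hf.tendsto 0).eventually_lt_const h0).filter_mono nhdsWithin_le_nhds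
    have e1 := ev (fun η => p + η) q (by fun_prop) (by simpa)
    have e2 := ev (fun η => σ * (q - p) - (s - η) * (q - 2)) 0 (by fun_prop) (by simpa)
    have e3 := ev (fun η => (s + η) * q) (N * (q - p)) (by fun_prop) (by simpa)
    have e4 := ev (fun η => s * q - N * (q - (p + η))) 0 (by fun_prop) (by simpa)
    obtain ⟨η, h⟩ := (e1.and (e2.and (e3.and (e4.and
      (self_mem_nhdsWithin (s := Set.Ioi (0 : ℝ))))))).exists
    exact ⟨η, ⟨h.1, sub_neg.1 h.2.1, h.2.2.1, sub_neg.1 h.2.2.2.1⟩, h.2.2.2.2⟩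
  have hq2 : 0 ≤ q - 2 := by linarith
  obtain ⟨K₁, hK₁⟩ := exists_lintegral_rpow_div_le (σ := σ) (p := p) (s := s + η) hp hpq
    (by nlinarith) h3 2
  obtain ⟨K₂, hK₂⟩ := exists_lintegral_rpow_div_le (σ := σ) (p := p) (s := s - η) hp hpq
    h2.le (by nlinarith) 2
  obtain ⟨K₃, hK₃⟩ := exists_lintegral_rpow_div_le (σ := σ) (p := p + η) (s := s) (by linarith) h1
    (by nlinarith) h4 2
  have hε2 : 0 < ε / 2 := ENNReal.half_pos hε
  -- L is fixed first, so that the three extreme regions contribute at most ε/2; the factor M = L^(p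
  -- - 2 + s) on the remaining region is then a constant, and the local L^2 integral is required to
  -- be at most ε / (2 M).
  obtain ⟨L, hLε, hL⟩ : ∃ L : ℝ, ENNReal.ofReal (L ^ (-η)) * (K₁ + K₂ + K₃ : NNReal) < ε / 2 ∧
      1 ≤ L := by
    have ht : Tendsto (fun L : ℝ => ENNReal.ofReal (L ^ (-η)) * (K₁ + K₂ + K₃ : NNReal)) atTop
        (𝓝 (ENNReal.ofReal 0 * (K₁ + K₂ + K₃ : NNReal))) :=
      ENNReal.Tendsto.mul_const (ENNReal.tendsto_ofReal (tendsto_rpow_neg_atTop hη))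
        (Or.inr ENNReal.coe_ne_top)
    rw [ENNReal.ofReal_zero, zero_mul] at ht
    exact ((ht.eventually_lt_const hε2).and (eventually_ge_atTop 1)).exists
  set M := ENNReal.ofReal (L ^ (p - 2 + s)) with hM
  have hM0 : M ≠ 0 := by
    rw [hM, ne_eq, ENNReal.ofReal_eq_zero, not_le]
    have := one_pos.trans_le hL
    positivity
  have hMt : M ≠ ⊤ := ENNReal.ofReal_ne_top
  obtain ⟨l, hl, S, hS, δ, hδ, hctrl⟩ := exists_averages_control N σ L 2 (ε := ε / 2 / M)
    (ENNReal.div_pos hε2.ne' hMt).ne'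
  choose φ hφ using fun c => exists_ballIntegral (σ := σ) (c : EuclideanSpace ℝ (Fin N)) l
  refine ⟨φ '' S, hS.image φ, δ, hδ, fun u hu huS => ?_⟩
  have hu2 : ‖u‖ₑ ≤ ((2 : NNReal) : ℝ≥0∞) := by
    rw [← ofReal_norm]
    exact (ENNReal.ofReal_le_ofReal hu).trans (by simp)
  have hum : Measurable u.toFun := u.stronglyMeasurable.measurable
  have hloc := hctrl u hu2 fun c hc => by
    rw [← hφ]; exact huS _ (Set.mem_image_of_mem φ hc)
  calc ∫⁻ x, ENNReal.ofReal (|u.toFun x| ^ p / ‖x‖ ^ s)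
      ≤ ∫⁻ x, (ENNReal.ofReal (L ^ (-η)) * (ENNReal.ofReal (|u.toFun x| ^ p / ‖x‖ ^ (s + η)) +
          ENNReal.ofReal (|u.toFun x| ^ p / ‖x‖ ^ (s - η)) +
          ENNReal.ofReal (|u.toFun x| ^ (p + η) / ‖x‖ ^ s)) +
          (Metric.ball 0 L).indicator (fun x => M * ‖u.toFun x‖ₑ ^ 2) x) := by
        refine lintegral_mono_ae ?_
        filter_upwards [Measure.ae_ne volume (0 : EuclideanSpace ℝ (Fin N))] with x hx
        refine (ENNReal.ofReal_le_ofReal (rpow_div_rpow_le_of_one_le (abs_nonneg (u.toFun x))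
          (norm_pos_iff.2 hx) hp hs hη hL)).trans ?_
        have hL0 := one_pos.trans_le hL
        rw [ENNReal.ofReal_add (by positivity) (by split_ifs <;> positivity),
          ENNReal.ofReal_mul (by positivity), ENNReal.ofReal_add (by positivity) (by positivity),
          ENNReal.ofReal_add (by positivity) (by positivity)]
        gcongr
        simp only [Set.indicator, mem_ball_zero_iff]
        split_ifs
        · rw [ENNReal.ofReal_mul (by positivity), ENNReal.ofReal_pow (abs_nonneg _),
            ← Real.norm_eq_abs, ofReal_norm]
        · simp
    _ = ENNReal.ofReal (L ^ (-η)) * ((∫⁻ x, ENNReal.ofReal (|u.toFun x| ^ p / ‖x‖ ^ (s + η))) +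
          (∫⁻ x, ENNReal.ofReal (|u.toFun x| ^ p / ‖x‖ ^ (s - η))) +
          ∫⁻ x, ENNReal.ofReal (|u.toFun x| ^ (p + η) / ‖x‖ ^ s)) +
          M * ∫⁻ x in Metric.ball 0 L, ‖u.toFun x‖ₑ ^ 2 := by
        rw [lintegral_add_left (by fun_prop), lintegral_const_mul _ (by fun_prop),
          lintegral_add_left (by fun_prop), lintegral_add_left (by fun_prop),
          lintegral_indicator Metric.isOpen_ball.measurableSet,
          lintegral_const_mul _ (by fun_prop)]
    _ ≤ ENNReal.ofReal (L ^ (-η)) * (K₁ + K₂ + K₃ : NNReal) + M * (ε / 2 / M) := by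
        push_cast
        gcongr
        · exact hK₁ u hu2
        · exact hK₂ u hu2
        · exact hK₃ u hu2
    _ ≤ ε / 2 + ε / 2 := by
        gcongr
        rw [ENNReal.mul_div_cancel hM0 hMt]
    _ = ε := ENNReal.add_halves ε

theorem exists_embedding {p s : ℝ} [Fact (1 ≤ ENNReal.ofReal p)] (hp : 2 ≤ p)
    (hpq : p < hardySobolevExponent N 0)
    (hout : σ * (hardySobolevExponent N 0 - p) ≤ s * (hardySobolevExponent N 0 - 2))
    (hin : s * hardySobolevExponent N 0 < N * (hardySobolevExponent N 0 - p)) :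
    ∃ ι : ESpace N σ →L[ℝ] Lp ℝ (ENNReal.ofReal p) (weightedVolume N s),
      ∀ u : ESpace N σ, (ι u : EuclideanSpace ℝ (Fin N) → ℝ) =ᵐ[weightedVolume N s] u.toFun := by
  have hp0 : 0 < p := by linarith
  have hac := weightedVolume_absolutelyContinuous (N := N) s
  have hle : ∀ ρ : NNReal, ∃ K : NNReal, ∀ u : ESpace N σ, ‖u‖ₑ ≤ ρ →
      eLpNorm u.toFun (ENNReal.ofReal p) (weightedVolume N s) ≤ (K : ℝ≥0∞) := by
    intro ρ
    obtain ⟨K, hK⟩ := exists_lintegral_rpow_div_le (N := N) hp hpq hout hin ρ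
    refine ⟨K ^ p⁻¹, fun u hu => ?_⟩
    rw [← ENNReal.rpow_le_rpow_iff hp0, eLpNorm_weightedVolume_rpow hp0,
      ENNReal.coe_rpow_of_nonneg _ (by positivity), ENNReal.rpow_inv_rpow hp0.ne']
    exact hK u hu
  have hmem : ∀ u : ESpace N σ, MemLp u.toFun (ENNReal.ofReal p) (weightedVolume N s) := by
    intro u
    obtain ⟨K, hK⟩ := hle ‖u‖₊
    exact ⟨u.stronglyMeasurable.aestronglyMeasurable,
      (hK u le_rfl).trans_lt ENNReal.coe_lt_top⟩
  let ι : ESpace N σ →ₗ[ℝ] Lp ℝ (ENNReal.ofReal p) (weightedVolume N s) :=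
    { toFun := fun u => (hmem u).toLp _
      map_add' := fun u v => by
        rw [← MemLp.toLp_add]
        exact MemLp.toLp_congr _ _ (hac.ae_eq (toFun_add u v))
      map_smul' := fun c u => by
        rw [RingHom.id_apply, ← MemLp.toLp_const_smul]
        exact MemLp.toLp_congr _ _ (hac.ae_eq (toFun_smul c u)) }
  obtain ⟨K, hK⟩ := hle 1
  have hball : ∀ u : ESpace N σ, ‖u‖ ≤ 1 → ‖ι u‖ ≤ K := by
    intro u hu
    have h1 : ‖u‖ₑ ≤ ((1 : NNReal) : ℝ≥0∞) := by
      rw [← ofReal_norm]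
      exact (ENNReal.ofReal_le_ofReal hu).trans (by simp)
    have := ENNReal.toReal_mono ENNReal.coe_ne_top (hK u h1)
    rwa [← Lp.norm_toLp _ (hmem u)] at this
  -- The integral bound is not homogeneous in u; only its consequence on the unit ball is kept, and
  -- scaling u to norm 1 yields the operator bound.
  refine ⟨ι.mkContinuous K fun u => ?_, fun u => (hmem u).coeFn_toLp⟩
  rcases eq_or_ne u 0 with rfl | hu
  · simp
  have hu' : 0 < ‖u‖ := norm_pos_iff.2 hu
  have h := hball (‖u‖⁻¹ • u) (by rw [norm_smul, norm_inv, norm_norm, inv_mul_cancel₀ hu'.ne'])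
  rwa [map_smul, norm_smul, norm_inv, norm_norm, inv_mul_le_iff₀ hu', mul_comm] at h

end ESpace

/-! ### From the hypotheses on p to the two linear conditions -/

theorem mainTheorem11 (N : ℕ) [Fact (3 ≤ N)] (σ s p : ℝ)
    (hσ : σ ∈ Set.Ico (0 : ℝ) 2) (hs : s ∈ Set.Ico (0 : ℝ) 2)
    (hp : (σ ≤ s ∧ 2 < p ∧ p < hardySobolevExponent N s) ∨
      (s < σ ∧ 2 + 4 / σ * ((σ - s) / ((N : ℝ) - 2)) ≤ p ∧ p < hardySobolevExponent N s)) :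
    ∃ (_ : Fact (1 ≤ ENNReal.ofReal p))
      (ι : ESpace N σ →L[ℝ] Lp ℝ (ENNReal.ofReal p) (weightedVolume N s)),
      (∀ u : ESpace N σ, (ι u : EuclideanSpace ℝ (Fin N) → ℝ) =ᵐ[volume] u.toFun) ∧
      Function.Injective ι ∧
      ((σ < s ∨ (0 < s ∧ s ≤ σ ∧ 2 + 4 / σ * ((σ - s) / ((N : ℝ) - 2)) < p)) →
        IsCompactOperator ι) := by
  have hN : (3 : ℝ) ≤ N := by exact_mod_cast Fact.out (p := 3 ≤ N)
  have hN2 : (0 : ℝ) < N - 2 := by linarith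
  set q := hardySobolevExponent N 0 with hq
  have hq2 : q - 2 = 4 / ((N : ℝ) - 2) := by
    rw [hq, hardySobolevExponent]; field_simp; ring
  have hq2pos : 0 < q - 2 := by rw [hq2]; positivity
  -- Since q - 2 = 4 / (N - 2), the lower bound on p multiplied by σ becomes σ (p - 2) ≥ (σ - s) (q
  -- - 2), which rearranges to `hout`.
  have hlower : ∀ hσ0 : 0 < σ, σ * (2 + 4 / σ * ((σ - s) / ((N : ℝ) - 2)) - 2) =
      (σ - s) * (q - 2) := fun hσ0 => by
    rw [hq2]; field_simp; ring
  have hps : p < hardySobolevExponent N s := by rcases hp with h | h <;> exact h.2.2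
  have hp2 : 2 < p := by
    rcases hp with h | h
    · exact h.2.1
    · have hσ0 : 0 < σ := hs.1.trans_lt h.1
      have : 0 < 4 / σ * ((σ - s) / ((N : ℝ) - 2)) := by
        have := sub_pos.2 h.1
        positivity
      linarith [h.2.1]
  have hNs : N * hardySobolevExponent N s = (N - s) * q := by
    rw [hq, hardySobolevExponent, hardySobolevExponent]; field_simp; ring
  -- This is N p < N 2^*(s) = (N - s) q.
  have hin : s * q < N * (q - p) := by nlinarith
  have hpq : p < q := by nlinarith [mul_nonneg hs.1 (by linarith : 0 ≤ q)]
  have hout : σ * (q - p) ≤ s * (q - 2) := by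
    rcases hp with h | h
    -- Here σ (q - p) ≤ σ (q - 2) ≤ s (q - 2), because p > 2 and σ ≤ s.
    · nlinarith [hσ.1]
    · have hσ0 : 0 < σ := hs.1.trans_lt h.1
      nlinarith [hlower hσ0, mul_le_mul_of_nonneg_left h.2.1 hσ0.le]
  have hfact : Fact (1 ≤ ENNReal.ofReal p) := ⟨ENNReal.one_le_ofReal.2 (by linarith)⟩
  obtain ⟨ι, hι⟩ := ESpace.exists_embedding (σ := σ) hp2.le hpq hout hin
  -- The weighted measure and Lebesgue measure have the same null sets, so the image in L^p
  -- determines the element of E.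
  have hιv : ∀ u : ESpace N σ, (ι u : EuclideanSpace ℝ (Fin N) → ℝ) =ᵐ[volume] u.toFun :=
    fun u => (absolutelyContinuous_weightedVolume s).ae_eq (hι u)
  refine ⟨hfact, ι, hιv, fun u v huv => ?_, fun hc => ?_⟩
  · exact Subtype.ext (AEEqFun.ext ((hιv u).symm.trans (huv ▸ hιv v)))
  -- Strictness comes from σ < s in the first case and from the strict lower bound on p in the
  -- second.
  have hout' : σ * (q - p) < s * (q - 2) := by
    rcases hc with h | ⟨h0, h1, h2⟩
    · nlinarith [hσ.1]
    · have hσ0 : 0 < σ := h0.trans_le h1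
      nlinarith [hlower hσ0, mul_lt_mul_of_pos_left h2 hσ0]
  refine isCompactOperator_of_finite_functionals ι fun ε hε => ?_
  have hp0 : 0 < p := by linarith
  obtain ⟨S, hS, δ, hδ, h⟩ := ESpace.exists_finite_functionals_control hσ.1 hs.1 hp2.le hpq hout' hin
    (ε := ENNReal.ofReal ε ^ p) (by positivity)
  refine ⟨S, hS, δ, hδ, fun w hw hwS => ?_⟩
  have h' := h w hw hwS
  rw [← eLpNorm_weightedVolume_rpow hp0, ENNReal.rpow_le_rpow_iff hp0,
    ← eLpNorm_congr_ae (hι w)] at h'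
  rw [Lp.norm_def]
  exact ENNReal.toReal_le_of_le_ofReal hε.le h'
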